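/- An exponential on an ordered field $(K,<)$ is an isomorphism of ordered groups $f$ from $(K,+,0,<)$ onto the multiplicative group $(K^{>0},\cdot,1,<)$ of positive elements. Let $k$ be an ordered field and $G$ a nontrivial (totally) ordered abelian group. Let $K=k((G))$ be the field of generalized power series with well-ordered support in $G$ and coefficients in $k$, let $w:K\to G\cup\{\infty\}$ be its canonical valuation (the least element of the support, with $w(0)=\infty$), and let $R_w=\{a\in K: wa\ge 0\}$ and $I_w=\{a\in K: wa>0\}$, so that $R_w/I_w=k$. Let $<$ be any total order on $K$ that makes it an ordered field. Call an exponential $f$ on $(K,<)$ compatible if $f(R_w)=\{a\in K: wa=0,\ a>0\}$ and $f(I_w)=1+I_w$, that is, if it induces an exponential on $k$ through the residue map, where $k$ carries the order induced by $<$. Then $(K,<)$ admits no compatible exponential. If moreover the given order on $k$ is archimedean, then $(K,<)$ admits no exponential at all. -/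

import Mathlib

/-- An exponential on the ordered field `K`: an isomorphism from the ordered additive group
`(K, +, 0, <)` onto the ordered multiplicative group `(K^{>0}, *, 1, <)` of positive elements. -/
abbrev OrderedExponential (K : Type*) [Field K] [LinearOrder K] [IsStrictOrderedRing K] : Type _ :=
  Multiplicative K ≃*o {x : K // 0 < x}

/-- The exponential `f`, read as a map from `K` to `K`. -/
def OrderedExponential.map {K : Type*} [Field K] [LinearOrder K] [IsStrictOrderedRing K]
    (f : OrderedExponential K) (x : K) : K :=
  (f (Multiplicative.ofAdd x) : {x : K // 0 < x})

/-- `f` is compatible with the valuation `w`, with valuation ring `R = {x | 0 ≤ w x}` and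
valuation ideal `I = {x | 0 < w x}`: it maps `R` onto the group of positive units of `R`
and `I` onto `1 + I`. -/
def OrderedExponential.CompatibleWith {K : Type*} [Field K] [LinearOrder K]
    [IsStrictOrderedRing K] {Γ₀ : Type*} [LinearOrderedAddCommMonoidWithTop Γ₀]
    (f : OrderedExponential K) (w : AddValuation K Γ₀) : Prop :=
  OrderedExponential.map f '' {x : K | 0 ≤ w x} = {y : K | w y = 0 ∧ 0 < y} ∧
  OrderedExponential.map f '' {x : K | 0 < w x} = (fun x : K => 1 + x) '' {x : K | 0 < w x}

/-! An exponential makes every positive series a square, so signs in K are read off leading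
coefficients. Suppose an exponential `e` has `0 ≤ x.order` iff `(e x).order = 0`. Choose positive
x_i of negative order with x_i.order < (e x_{i+1}).order, and define F(α,i) as the order of e(x_i -
∑_{β<α} t^F(β,i+1)) by recursion on the ordinal α, for all i at once. Then F is negative and
strictly increasing in α (`expExponents_neg_and_lt`), so the ordinals inject into G, which is
absurd. Compatibility gives the hypothesis on orders directly; for archimedean k, rescaling the
argument so that e(1) = 2 gives it. -/

namespace HahnSeries

section

variable {G k : Type*} [LinearOrder G] [Field k]

open Classical in
/-- The series with coefficient `1` at the exponents in `S` and `0` elsewhere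
(the zero series if `S` is not partially well-ordered). -/
noncomputable def ofSupport (k : Type*) [Field k] (S : Set G) : HahnSeries G k :=
  if h : S.IsPWO then
    ⟨S.indicator 1, h.mono fun _ hx => Set.mem_of_indicator_ne_zero hx⟩
  else 0

theorem coeff_ofSupport_of_mem {S : Set G} (h : S.IsPWO) {g : G} (hg : g ∈ S) :
    (ofSupport k S).coeff g = 1 := by
  simp [ofSupport, h, hg]

theorem coeff_ofSupport_of_notMem {S : Set G} {g : G} (hg : g ∉ S) :
    (ofSupport k S).coeff g = 0 := by
  unfold ofSupport
  split_ifs <;> simp [hg]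

theorem le_orderTop_ofSupport {S : Set G} {a : G} (ha : ∀ g ∈ S, a ≤ g) :
    (a : WithTop G) ≤ (ofSupport k S).orderTop := by
  refine le_orderTop_iff_forall.2 fun g hg => coeff_ofSupport_of_notMem fun hgS => ?_
  exact absurd (ha g hgS) (not_le.2 (WithTop.coe_lt_coe.1 hg))

end

/-! ### Signs and leading coefficients -/

section

variable {G k : Type*} [AddCommGroup G] [LinearOrder G] [IsOrderedAddMonoid G]
  [Field k] [LinearOrder k] [IsStrictOrderedRing k]

omit [IsOrderedAddMonoid G] [LinearOrder k] [IsStrictOrderedRing k] in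
theorem order_eq_of_coeff {y : HahnSeries G k} {g : G} (hg : y.coeff g ≠ 0)
    (hlt : ∀ h < g, y.coeff h = 0) : y.order = g := by
  refine le_antisymm (order_le_of_coeff_ne_zero hg) ?_
  by_contra! h
  have hy : y ≠ 0 := by
    rintro rfl
    simp at hg
  exact leadingCoeff_ne_zero.2 hy (leadingCoeff_eq.trans (hlt _ h))

variable [LinearOrder (HahnSeries G k)] [IsStrictOrderedRing (HahnSeries G k)]

/-- The leading coefficient of a nonzero square is itself a nonzero square, hence positive in any
order on k. -/
theorem pos_iff_leadingCoeff_pos_of_isSquare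
    (hsq : ∀ x : HahnSeries G k, 0 < x → IsSquare x) (x : HahnSeries G k) :
    0 < x ↔ 0 < x.leadingCoeff := by
  have key : ∀ y : HahnSeries G k, 0 < y → 0 < y.leadingCoeff := by
    intro y hy
    obtain ⟨b, rfl⟩ := hsq y hy
    have hb : b ≠ 0 := by
      rintro rfl
      simp at hy
    rw [leadingCoeff_mul]
    exact mul_self_pos.2 (leadingCoeff_ne_zero.2 hb)
  refine ⟨key x, fun h => ?_⟩
  rcases lt_trichotomy 0 x with hx | rfl | hx
  · exact hx
  · simp at h
  · have := key (-x) (neg_pos.2 hx)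
    rw [leadingCoeff_neg] at this
    linarith

variable (hpos : ∀ x : HahnSeries G k, 0 < x ↔ 0 < x.leadingCoeff)
include hpos

omit [IsStrictOrderedRing k] in
theorem order_le_order_of_pos_of_le {x y : HahnSeries G k} (hx : 0 < x) (hxy : x ≤ y) :
    y.order ≤ x.order := by
  by_contra! h
  have hy := hx.trans_le hxy
  have hT : x.orderTop < y.orderTop := by
    rw [← order_eq_orderTop_of_ne_zero hx.ne', ← order_eq_orderTop_of_ne_zero hy.ne']
    exact WithTop.coe_lt_coe.2 h
  have : 0 < x - y := by
    rw [hpos, leadingCoeff_sub hT]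
    exact (hpos x).1 hx
  exact absurd hxy (not_le.2 (sub_pos.1 this))

omit [IsOrderedAddMonoid G] [IsStrictOrderedRing k] [IsStrictOrderedRing (HahnSeries G k)] in
theorem pos_of_coeff_zero_pos {y : HahnSeries G k} (hy : 0 ≤ y.order) (hc : 0 < y.coeff 0) :
    0 < y := by
  have : y.order = 0 := le_antisymm (order_le_of_coeff_ne_zero hc.ne') hy
  rw [hpos, leadingCoeff_eq, this]
  exact hc

end

/-! ### The transfinite recursion -/

section

universe u v

variable {G : Type u} {k : Type v} [AddCommGroup G] [LinearOrder G] [IsOrderedAddMonoid G]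
  [Field k] [LinearOrder k] [IsStrictOrderedRing k]
  [LinearOrder (HahnSeries G k)] [IsStrictOrderedRing (HahnSeries G k)]

/-- The orders of `e (x i - ∑ t ^ γ)`, where `γ` runs over the exponents of the next level
at the smaller ordinals. -/
noncomputable def expExponents (e : HahnSeries G k → HahnSeries G k) (x : ℕ → HahnSeries G k) :
    Ordinal.{u} → ℕ → G :=
  WellFounded.fix Ordinal.lt_wf fun α F i =>
    (e (x i - ofSupport k {g | ∃ β, ∃ h : β < α, F β h (i + 1) = g})).order

omit [IsOrderedAddMonoid G] [LinearOrder k] [IsStrictOrderedRing k]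
  [LinearOrder (HahnSeries G k)] [IsStrictOrderedRing (HahnSeries G k)] in
theorem expExponents_eq (e : HahnSeries G k → HahnSeries G k) (x : ℕ → HahnSeries G k)
    (α : Ordinal.{u}) (i : ℕ) :
    expExponents e x α i =
      (e (x i - ofSupport k ((fun β => expExponents e x β (i + 1)) '' Set.Iio α))).order := by
  rw [expExponents, WellFounded.fix_eq]
  congr 4
  ext g
  simp

variable (hpos : ∀ x : HahnSeries G k, 0 < x ↔ 0 < x.leadingCoeff)
  {e : HahnSeries G k → HahnSeries G k}
  (hadd : ∀ x y, e (x + y) = e x * e y) (he : ∀ x, 0 < e x) (hmono : StrictMono e)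
  (hunit : ∀ x, 0 ≤ x.order ↔ (e x).order = 0)

omit [IsStrictOrderedRing (HahnSeries G k)] in
include hadd he in
theorem exp_zero_eq_one : e 0 = 1 := by
  have := hadd 0 0
  rw [add_zero] at this
  exact (mul_eq_left₀ (he 0).ne').1 this.symm

include hpos hadd he hmono hunit

theorem order_exp_neg {x : HahnSeries G k} (hx : 0 < x) (hxo : x.order < 0) :
    (e x).order < 0 := by
  have h1 : 1 ≤ e x := by
    rw [← exp_zero_eq_one hadd he]
    exact (hmono hx).le
  have h2 := order_le_order_of_pos_of_le hpos zero_lt_one h1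
  rw [order_one] at h2
  refine lt_of_le_of_ne h2 fun h => ?_
  exact absurd ((hunit x).2 h) (not_le.2 hxo)

/-- Half the logarithm of x works: x = (e z)², so the order of x is twice the negative order of e z.
-/
theorem exists_order_lt_order_exp (hsurj : ∀ y, 0 < y → ∃ x, e x = y) {x : HahnSeries G k}
    (hx : 0 < x) (hxo : x.order < 0) :
    ∃ z : HahnSeries G k, (0 < z ∧ z.order < 0) ∧ x.order < (e z).order := by
  obtain ⟨l, hl⟩ := hsurj x hx
  obtain ⟨z, rfl⟩ : ∃ z, l = z + z := ⟨l / 2, (add_halves l).symm⟩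
  rw [hadd] at hl
  have ho : x.order = (e z).order + (e z).order := by
    rw [← hl, order_mul (he z).ne' (he z).ne']
  have hzo : z.order < 0 := by
    by_contra! h
    rw [(hunit z).1 h, add_zero] at ho
    exact hxo.ne ho
  have hz : 0 < z := by
    by_contra! h
    have h1 : e z ≤ 1 := by
      rw [← exp_zero_eq_one hadd he]
      exact hmono.monotone h
    have h2 : x ≤ 1 := hl ▸ mul_le_one₀ h1 (he z).le h1
    have h3 := order_le_order_of_pos_of_le hpos hx h2
    rw [order_one] at h3
    exact absurd hxo (not_lt.2 h3)
  refine ⟨z, ⟨hz, hzo⟩, ?_⟩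
  rw [ho]
  exact add_lt_of_neg_left _ (order_exp_neg hpos hadd he hmono hunit hz hzo)

theorem expExponents_neg_and_lt {x : ℕ → HahnSeries G k} (hx : ∀ i, 0 < x i)
    (hxo : ∀ i, (x i).order < 0) (hxe : ∀ i, (x i).order < (e (x (i + 1))).order)
    (α : Ordinal.{u}) :
    ∀ i, expExponents e x α i < 0 ∧
      ∀ β < α, expExponents e x β i < expExponents e x α i := by
  induction α using WellFoundedLT.induction with
  | ind α IH =>
  intro i
  set F := expExponents e x with hF
  set A : Ordinal.{u} → Set G := fun β => (fun β => F β (i + 1)) '' Set.Iio β with hA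
  have hFA : ∀ β, F β i = (e (x i - ofSupport k (A β))).order := fun β => expExponents_eq e x β i
  -- Monotonicity below α rules out the default value 0 of `ofSupport`.
  have hPWO : ∀ β ≤ α, (A β).IsPWO := by
    intro β hβ
    refine Set.IsPWO.image_of_monotoneOn (Set.IsWF.isPWO (Set.IsWF.of_wellFoundedLT _)) ?_
    intro a ha b hb hab
    rcases hab.eq_or_lt with rfl | hab
    · exact le_rfl
    · exact ((IH b (lt_of_lt_of_le hb hβ) (i + 1)).2 a hab).le
  have hF0 : F 0 (i + 1) = (e (x (i + 1))).order := by
    rw [hF, expExponents_eq]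
    have : ofSupport k ((fun β => F β (i + 1 + 1)) '' Set.Iio (0 : Ordinal.{u})) = 0 := by
      ext g
      rw [coeff_ofSupport_of_notMem, coeff_zero]
      rintro ⟨b, hb, -⟩
      exact not_lt_zero (Set.mem_Iio.1 hb)
    rw [this, sub_zero]
  -- The least possible exponent is F(0,i+1), the order of e(x_{i+1}), so x_i dominates the sum.
  have hlow : ∀ β ≤ α, (x i).orderTop < (ofSupport k (A β)).orderTop := by
    intro β hβ
    refine lt_of_lt_of_le ?_ (le_orderTop_ofSupport (a := F 0 (i + 1)) ?_)
    · rw [← order_eq_orderTop_of_ne_zero (hx i).ne', hF0]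
      exact WithTop.coe_lt_coe.2 (hxe i)
    · rintro _ ⟨b, hb, rfl⟩
      rcases eq_or_ne b 0 with rfl | hb0
      · exact le_rfl
      · exact ((IH b (lt_of_lt_of_le hb hβ) (i + 1)).2 0 (pos_iff_ne_zero.2 hb0)).le
  constructor
  · rw [hFA]
    refine order_exp_neg hpos hadd he hmono hunit ?_ ?_
    · rw [hpos, leadingCoeff_sub (hlow α le_rfl)]
      exact (hpos _).1 (hx i)
    · have h := orderTop_sub (hlow α le_rfl)
      by_contra! h0
      rw [← zero_le_orderTop_iff, h, zero_le_orderTop_iff] at h0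
      exact absurd (hxo i) (not_lt.2 h0)
  · intro β hβ
    -- D is the sum over β ≤ γ < α, with leading term t^F(β,i+1); being positive of negative order,
    -- it has e(D) of negative order.
    set D := ofSupport k (A α) - ofSupport k (A β) with hD
    have hnot : F β (i + 1) ∉ A β := by
      rintro ⟨b, hb, h⟩
      exact ((IH β hβ (i + 1)).2 b hb).ne h
    have hmem : F β (i + 1) ∈ A α := ⟨β, hβ, rfl⟩
    have hc : D.coeff (F β (i + 1)) = 1 := by
      rw [hD, coeff_sub, coeff_ofSupport_of_mem (hPWO α le_rfl) hmem,
        coeff_ofSupport_of_notMem hnot, sub_zero]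
    have ho : D.order = F β (i + 1) := by
      refine order_eq_of_coeff (by simp [hc]) fun h hh => ?_
      rw [hD, coeff_sub]
      by_cases hm : h ∈ A β
      · have hm' : h ∈ A α := by
          obtain ⟨b, hb, rfl⟩ := hm
          exact ⟨b, lt_trans hb hβ, rfl⟩
        rw [coeff_ofSupport_of_mem (hPWO α le_rfl) hm',
          coeff_ofSupport_of_mem (hPWO β hβ.le) hm, sub_self]
      · have hm' : h ∉ A α := by
          rintro ⟨b, hb, rfl⟩
          rcases lt_trichotomy b β with h1 | rfl | h1
          · exact hm ⟨b, h1, rfl⟩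
          · exact lt_irrefl _ hh
          · exact lt_asymm hh ((IH b hb (i + 1)).2 β h1)
        rw [coeff_ofSupport_of_notMem hm', coeff_ofSupport_of_notMem hm, sub_self]
    have hDpos : 0 < D := by
      rw [hpos, leadingCoeff_eq, ho, hc]
      exact zero_lt_one
    have hDneg : D.order < 0 := ho ▸ (IH β hβ (i + 1)).1
    have hsplit : x i - ofSupport k (A β) = (x i - ofSupport k (A α)) + D := by
      rw [hD]
      abel
    rw [hFA, hFA, hsplit, hadd, order_mul (he _).ne' (he _).ne']
    exact add_lt_of_neg_right _ (order_exp_neg hpos hadd he hmono hunit hDpos hDneg)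

theorem not_exp_of_order_eq_zero_iff [Nontrivial G] (hsurj : ∀ y, 0 < y → ∃ x, e x = y) :
    False := by
  obtain ⟨g, hg⟩ := exists_lt (0 : G)
  have hstep (x : {x : HahnSeries G k // 0 < x ∧ x.order < 0}) :
      ∃ z : {x : HahnSeries G k // 0 < x ∧ x.order < 0}, x.1.order < (e z.1).order := by
    obtain ⟨z, hz, h⟩ :=
      exists_order_lt_order_exp hpos hadd he hmono hunit hsurj x.2.1 x.2.2
    exact ⟨⟨z, hz⟩, h⟩
  choose s hs using hstep
  have h0 : 0 < (single g (1 : k)) ∧ (single g (1 : k)).order < 0 := by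
    rw [hpos, leadingCoeff_of_single, order_single one_ne_zero]
    exact ⟨zero_lt_one, hg⟩
  let x : ℕ → {x : HahnSeries G k // 0 < x ∧ x.order < 0} := fun n => s^[n] ⟨_, h0⟩
  have hlt := expExponents_neg_and_lt hpos hadd he hmono hunit (x := fun n => (x n).1)
    (fun i => (x i).2.1) (fun i => (x i).2.2) (fun i => by
      simp only [x, Function.iterate_succ_apply']
      exact hs _)
  refine not_injective_of_ordinal (fun α : Ordinal.{u} => expExponents e (fun n => (x n).1) α 0)
    (StrictMono.injective fun β α h => (hlt α 0).2 β h)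

end

/-! ### Archimedean residue field -/

section

variable {G k : Type*} [AddCommGroup G] [LinearOrder G] [IsOrderedAddMonoid G]
  [Field k] [LinearOrder k] [IsStrictOrderedRing k]
  [LinearOrder (HahnSeries G k)] [IsStrictOrderedRing (HahnSeries G k)]

omit [LinearOrder k] [IsStrictOrderedRing k] [LinearOrder (HahnSeries G k)]
  [IsStrictOrderedRing (HahnSeries G k)] in
theorem order_natCast_eq_zero (n : ℕ) : (n : HahnSeries G k).order = 0 := by
  have : (n : HahnSeries G k) = C (n : k) := (map_natCast C n).symm
  rw [this, order_C]

theorem exists_nat_gt_of_order_nonneg [Archimedean k]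
    (hpos : ∀ x : HahnSeries G k, 0 < x ↔ 0 < x.leadingCoeff)
    {x : HahnSeries G k} (hx : 0 ≤ x.order) : ∃ n : ℕ, x < n := by
  obtain ⟨n, hn⟩ := exists_nat_gt (x.coeff 0)
  refine ⟨n, sub_pos.1 (pos_of_coeff_zero_pos hpos ?_ ?_)⟩
  · rw [← zero_le_orderTop_iff] at hx ⊢
    refine le_trans (le_min ?_ hx) min_orderTop_le_orderTop_sub
    rw [zero_le_orderTop_iff, order_natCast_eq_zero]
  · have : (n : HahnSeries G k) = C (n : k) := (map_natCast C n).symm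
    rw [coeff_sub, this, C_apply, coeff_single_same]
    exact sub_pos.2 hn

/-- Series of nonnegative order lie below some natural number, and e(n) = 2^n has order 0. -/
theorem order_nonneg_iff_order_exp_eq_zero [Archimedean k]
    (hpos : ∀ x : HahnSeries G k, 0 < x ↔ 0 < x.leadingCoeff)
    {e : HahnSeries G k → HahnSeries G k}
    (hadd : ∀ x y, e (x + y) = e x * e y) (he : ∀ x, 0 < e x) (hmono : StrictMono e)
    (h1 : e 1 = 2) (x : HahnSeries G k) : 0 ≤ x.order ↔ (e x).order = 0 := by
  have hnat (n : ℕ) : e n = 2 ^ n := by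
    induction n with
    | zero => simpa using exp_zero_eq_one hadd he
    | succ n ih => rw [Nat.cast_succ, hadd, ih, h1, pow_succ]
  have horder (n : ℕ) : (e n).order = 0 := by
    rw [hnat, show (2 : HahnSeries G k) ^ n = ((2 ^ n : ℕ) : HahnSeries G k) by push_cast; rfl]
    exact order_natCast_eq_zero _
  have hneg (y : HahnSeries G k) : (e (-y)).order = -(e y).order := by
    rw [eq_neg_iff_add_eq_zero, ← order_mul (he _).ne' (he _).ne', ← hadd, neg_add_cancel,
      exp_zero_eq_one hadd he, order_one]
  constructor
  · have key (y : HahnSeries G k) (hy : 0 ≤ y.order) : 0 ≤ (e y).order := by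
      obtain ⟨n, hn⟩ := exists_nat_gt_of_order_nonneg hpos hy
      rw [← horder n]
      exact order_le_order_of_pos_of_le hpos (he y) (hmono hn).le
    intro hx
    have h2 := key (-x) (by rwa [order_neg])
    rw [hneg] at h2
    exact le_antisymm (neg_nonneg.1 h2) (key x hx)
  · have key (y : HahnSeries G k) (hy : (e y).order = 0) (hy0 : 0 < y) : 0 ≤ y.order := by
      obtain ⟨n, hn⟩ := exists_nat_gt_of_order_nonneg hpos hy.ge
      -- e(y) < n < 2^n = e(n) forces y < n.
      have hlt : e y < e n := by
        rw [hnat]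
        exact hn.trans (by exact_mod_cast Nat.lt_two_pow_self)
      rw [← order_natCast_eq_zero (k := k) (G := G) n]
      exact order_le_order_of_pos_of_le hpos hy0 (hmono.lt_iff_lt.1 hlt).le
    intro hx
    rcases lt_trichotomy 0 x with h | rfl | h
    · exact key x hx h
    · simp
    · rw [← order_neg]
      exact key (-x) (by rw [hneg, hx, neg_zero]) (neg_pos.2 h)

end

end HahnSeries

namespace OrderedExponential

variable {K : Type*} [Field K] [LinearOrder K] [IsStrictOrderedRing K] (f : OrderedExponential K)

theorem map_add (x y : K) : map f (x + y) = map f x * map f y := by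
  simp [map, ofAdd_add]

theorem map_pos (x : K) : 0 < map f x := (f (Multiplicative.ofAdd x)).2

theorem map_strictMono : StrictMono (map f) := fun _ _ h => f.strictMono h

theorem exists_map_eq {y : K} (hy : 0 < y) : ∃ x, map f x = y := by
  obtain ⟨x, hx⟩ := f.surjective ⟨y, hy⟩
  exact ⟨x.toAdd, congrArg Subtype.val hx⟩

include f in
theorem isSquare_of_pos {y : K} (hy : 0 < y) : IsSquare y := by
  obtain ⟨x, rfl⟩ := exists_map_eq f hy
  exact ⟨map f (x / 2), by rw [← map_add, add_halves]⟩

theorem CompatibleWith.nonneg_iff {Γ₀ : Type*} [LinearOrderedAddCommMonoidWithTop Γ₀]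
    {f : OrderedExponential K} {w : AddValuation K Γ₀} (h : CompatibleWith f w) (x : K) :
    0 ≤ w x ↔ w (map f x) = 0 := by
  constructor
  · intro hx
    exact (h.1.subset ⟨x, hx, rfl⟩ : map f x ∈ {y : K | w y = 0 ∧ 0 < y}).1
  · intro hx
    obtain ⟨z, hz, hzx⟩ := h.1.superset ⟨hx, map_pos f x⟩
    rwa [← (map_strictMono f).injective hzx]

end OrderedExponential

theorem theorem1 {k : Type*} [Field k] [LinearOrder k] [IsStrictOrderedRing k]
    {G : Type*} [AddCommGroup G] [LinearOrder G] [IsOrderedAddMonoid G] [Nontrivial G]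
    [LinearOrder (HahnSeries G k)] [IsStrictOrderedRing (HahnSeries G k)] :
    (¬ ∃ f : OrderedExponential (HahnSeries G k),
        OrderedExponential.CompatibleWith f (HahnSeries.addVal G k)) ∧
    (Archimedean k → IsEmpty (OrderedExponential (HahnSeries G k))) := by
  constructor
  · rintro ⟨f, hf⟩
    refine HahnSeries.not_exp_of_order_eq_zero_iff
      (HahnSeries.pos_iff_leadingCoeff_pos_of_isSquare fun x => f.isSquare_of_pos)
      f.map_add f.map_pos f.map_strictMono (fun x => ?_) fun y => f.exists_map_eq
    -- The zero series has `order` 0, so x = 0 needs no separate case.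
    have h := hf.nonneg_iff x
    rw [HahnSeries.addVal_apply, HahnSeries.zero_le_orderTop_iff,
      HahnSeries.addVal_apply_of_ne (f.map_pos x).ne'] at h
    exact h.trans WithTop.coe_eq_zero
  · intro _
    refine ⟨fun f => ?_⟩
    have hpos := HahnSeries.pos_iff_leadingCoeff_pos_of_isSquare
      fun x : HahnSeries G k => f.isSquare_of_pos
    obtain ⟨a, ha⟩ := f.exists_map_eq (zero_lt_two (α := HahnSeries G k))
    have ha0 : 0 < a := by
      rw [← f.map_strictMono.lt_iff_lt, ha,
        HahnSeries.exp_zero_eq_one f.map_add f.map_pos]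
      exact one_lt_two
    have hadd : ∀ x y, f.map (a * (x + y)) = f.map (a * x) * f.map (a * y) := fun x y => by
      rw [mul_add, f.map_add]
    have hmono : StrictMono fun x => f.map (a * x) :=
      f.map_strictMono.comp fun _ _ h => mul_lt_mul_of_pos_left h ha0
    refine HahnSeries.not_exp_of_order_eq_zero_iff hpos hadd (fun x => f.map_pos _) hmono
      (HahnSeries.order_nonneg_iff_order_exp_eq_zero hpos hadd (fun x => f.map_pos _) hmono
        (by rw [mul_one, ha])) fun y hy => ?_
    obtain ⟨z, hz⟩ := f.exists_map_eq hy
    exact ⟨z / a, by rw [mul_div_cancel₀ z ha0.ne', hz]⟩
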